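/- Let $d\ge 1$. Let $\Omega=\prod_{i=1}^d (a_i,\,a_i+N_i h)$ with $h>0$ and integers $N_i\ge 1$, and let $\mathcal T_h$ be the uniform Cartesian mesh of $\Omega$ consisting of the $\prod_i N_i$ axis-parallel cubes of edge length $h$; let $\mathcal F_h$ be the set of its interior and boundary faces. For $k\ge 1$ let $U_k(\mathcal T_h)$ be the space of functions on $\Omega$ whose restriction to each $T\in\mathcal T_h$ is a polynomial of degree at most $k$ in each variable. On an interior face $F=T_1\cap T_2$ with unit normal $\boldsymbol n$ pointing from $T_1$ to $T_2$ (the orientation is arbitrary but fixed) put $\{\!\{w\}\!\}=\tfrac12(w|_{T_1}+w|_{T_2})$ and $[\![w]\!]=w|_{T_1}-w|_{T_2}$; on a boundary face put $\{\!\{w\}\!\}=[\![w]\!]=w$ and let $\boldsymbol n$ be the outward unit normal to $\partial\Omega$. For $\alpha_0>0$ define the symmetric interior penalty (SIPDG) bilinear form on $U_k(\mathcal T_h)$ by \[ \mathcal A_k(u,v)=\sum_{T\in\mathcal T_h}\int_T\nabla u\cdot\nabla v-\sum_{F\in\mathcal F_h}\int_F\{\!\{\nabla u\}\!\}\cdot\boldsymbol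 n\,[\![v]\!]-\sum_{F\in\mathcal F_h}\int_F\{\!\{\nabla v\}\!\}\cdot\boldsymbol n\,[\![u]\!]+\sum_{F\in\mathcal F_h}\frac{\alpha_0k^2}{h}\int_F[\![u]\!][\![v]\!], \] where for $d=1$ the integral over a face is evaluation at a point. Let $l_n$ be the Legendre polynomial of degree $n$ on $[-1,1]$ with $l_n(1)=1$. For $T=\prod_i[x_i^l,x_i^l+h]\in\mathcal T_h$ and $\boldsymbol\sigma\in\{0,\dots,k\}^d$ let $\Psi_T^{\boldsymbol\sigma}(\boldsymbol x)=\prod_{i=1}^d l_{\sigma_i}\!\big(\tfrac2h(x_i-x_i^l)-1\big)$ on $T$, extended by zero outside $T$. Let $\mathbb A_k$ be the stiffness matrix of $\mathcal A_k$ in the basis $\{\Psi_T^{\boldsymbol\sigma}\}$ of $U_k(\mathcal T_h)$, and let $\mathbb D_k$ be the diagonal part of $\mathbb A_k$. Then, if the penalty constant $\alpha_0$ is large enough, $\rho(\mathbb D_k^{-1}\mathbb A_k)\lesssim k+1$. Precisely: for every $d\ge 1$ there is $\alpha_{\min}>0$ such that for every $\alpha_0\ge\alpha_{\min}$ there is a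 constant $C>0$, depending only on $d$ and $\alpha_0$ (in particular independent of the mesh and of $k$), such that for every mesh as above, every orientation of the interior faces and every $k\ge 1$ the matrix $\mathbb D_k$ is invertible and the spectral radius satisfies \[ \rho(\mathbb D_k^{-1}\mathbb A_k)\le C\,(k+1). \] -/

import Mathlib

noncomputable section

namespace SIPDG

/-- The Legendre polynomial of degree `n` (Rodrigues' formula, so that its value at `1` is `1`). -/
def legendre (n : ℕ) : Polynomial ℝ :=
  Polynomial.C ((2 ^ n * (n.factorial : ℝ))⁻¹) *
    Polynomial.derivative^[n] ((Polynomial.X ^ 2 - 1) ^ n)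

/-- A uniform Cartesian mesh of the box `∏ i, (origin i, origin i + N i * h)`:
it has `N i` cells of edge length `h` in the `i`-th coordinate direction. -/
structure UniformMesh (d : ℕ) where
  origin : Fin d → ℝ
  h : ℝ
  h_pos : 0 < h
  N : Fin d → ℕ
  N_pos : ∀ i, 0 < N i

/-- The gradient (vector of partial derivatives) of a function on `ℝ^d`. -/
def grad {d : ℕ} (u : (Fin d → ℝ) → ℝ) (x : Fin d → ℝ) : Fin d → ℝ :=
  fun i => fderiv ℝ u x (Pi.single i 1)

/-- The point of the hyperplane `x_i = c` whose other coordinates are `y`. -/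
def facePoint {d : ℕ} (i : Fin d) (c : ℝ) (y : {j : Fin d // j ≠ i} → ℝ) : Fin d → ℝ :=
  fun j => if hj : j = i then c else y ⟨j, hj⟩

namespace UniformMesh

variable {d : ℕ} (M : UniformMesh d)

/-- The elements (cells) of the mesh, given by their position in each coordinate direction. -/
abbrev Elem : Type := ∀ i : Fin d, Fin (M.N i)

/-- The lower corner of an element. -/
def lo (T : M.Elem) (i : Fin d) : ℝ := M.origin i + ((T i : ℕ) : ℝ) * M.h

/-- The upper corner of an element. -/
def hi (T : M.Elem) (i : Fin d) : ℝ := M.origin i + (((T i : ℕ) : ℝ) + 1) * M.h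

/-- The element `T` as a closed box in `ℝ^d`. -/
def cell (T : M.Elem) : Set (Fin d → ℝ) := Set.Icc (M.lo T) (M.hi T)

/-- An interior face: a coordinate direction `i` and an element `T` which is not the last one in
direction `i`; the face is the one shared by `T` and the next element in direction `i`. -/
abbrev InteriorFace : Type :=
  {F : Fin d × M.Elem // ((F.2 F.1 : Fin (M.N F.1)) : ℕ) + 1 < M.N F.1}

/-- A boundary face: a coordinate direction `i`, a side (`true` for the upper, `false` for the lower
one) and an element `T` which is the last (resp. first) one in direction `i`. -/
abbrev BoundaryFace : Type :=
  {F : Fin d × Bool × M.Elem //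
    (F.2.1 = true ∧ ((F.2.2 F.1 : Fin (M.N F.1)) : ℕ) + 1 = M.N F.1) ∨
    (F.2.1 = false ∧ ((F.2.2 F.1 : Fin (M.N F.1)) : ℕ) = 0)}

/-- All faces of the mesh. -/
abbrev Face : Type := M.InteriorFace ⊕ M.BoundaryFace

variable {M}

/-- The element adjacent to an interior face on its lower side. -/
def lowerElem (F : M.InteriorFace) : M.Elem := F.1.2

/-- The element adjacent to an interior face on its upper side. -/
def upperElem (F : M.InteriorFace) : M.Elem :=
  Function.update F.1.2 F.1.1 ⟨(F.1.2 F.1.1 : ℕ) + 1, F.2⟩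

/-- The integral over a face with respect to the `(d-1)`-dimensional Lebesgue measure
(evaluation at a point if `d = 1`). -/
def faceIntegral (F : M.Face) (g : (Fin d → ℝ) → ℝ) : ℝ :=
  match F with
  | Sum.inl F =>
      ∫ y in Set.Icc (fun j : {j : Fin d // j ≠ F.1.1} => M.lo F.1.2 j) (fun j => M.hi F.1.2 j),
        g (facePoint F.1.1 (M.hi F.1.2 F.1.1) y)
  | Sum.inr F =>
      ∫ y in Set.Icc (fun j : {j : Fin d // j ≠ F.1.1} => M.lo F.1.2.2 j)
          (fun j => M.hi F.1.2.2 j),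
        g (facePoint F.1.1
          (if F.1.2.1 = true then M.hi F.1.2.2 F.1.1 else M.lo F.1.2.2 F.1.1) y)

/-- An orientation chooses, for each interior face, whether the unit normal points in the positive
(`true`) or in the negative (`false`) coordinate direction. `firstElem` is the element `T₁` from
which the normal points out. -/
def firstElem (o : M.InteriorFace → Bool) (F : M.InteriorFace) : M.Elem :=
  if o F = true then lowerElem F else upperElem F

/-- The element `T₂` into which the normal of an interior face points. -/
def secondElem (o : M.InteriorFace → Bool) (F : M.InteriorFace) : M.Elem :=
  if o F = true then upperElem F else lowerElem F

/-- The unit normal of a face: from `T₁` to `T₂` on interior faces, outward on boundary faces. -/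
def normal (o : M.InteriorFace → Bool) : M.Face → (Fin d → ℝ)
  | Sum.inl F => Pi.single F.1.1 (if o F = true then 1 else -1)
  | Sum.inr F => Pi.single F.1.1 (if F.1.2.1 = true then 1 else -1)

/-- The jump on a face of an elementwise given function `u`
(`u T` is the function on `ℝ^d` whose restriction to the element `T` is `u|_T`). -/
def jump (o : M.InteriorFace → Bool) (F : M.Face) (u : M.Elem → (Fin d → ℝ) → ℝ)
    (x : Fin d → ℝ) : ℝ :=
  match F with
  | Sum.inl F => u (firstElem o F) x - u (secondElem o F) x
  | Sum.inr F => u F.1.2.2 x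

/-- The average on a face of an elementwise given vector field `w`. -/
def avg (o : M.InteriorFace → Bool) (F : M.Face) (w : M.Elem → (Fin d → ℝ) → (Fin d → ℝ))
    (x : Fin d → ℝ) : Fin d → ℝ :=
  match F with
  | Sum.inl F => (1 / 2 : ℝ) • w (firstElem o F) x + (1 / 2 : ℝ) • w (secondElem o F) x
  | Sum.inr F => w F.1.2.2 x

/-- The elementwise (broken) gradient. -/
def brokenGrad (u : M.Elem → (Fin d → ℝ) → ℝ) : M.Elem → (Fin d → ℝ) → (Fin d → ℝ) :=
  fun T => grad (u T)

variable (M)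

/-- The symmetric interior penalty bilinear form at level `k`, with penalty
parameter `α = α₀ k² / h`. -/
def form (o : M.InteriorFace → Bool) (α₀ : ℝ) (k : ℕ)
    (u v : M.Elem → (Fin d → ℝ) → ℝ) : ℝ :=
  (∑ T : M.Elem, (∫ x in M.cell T, grad (u T) x ⬝ᵥ grad (v T) x))
  - (∑ F : M.Face, faceIntegral F
      (fun x => (avg o F (brokenGrad u) x ⬝ᵥ normal o F) * jump o F v x))
  - (∑ F : M.Face, faceIntegral F
      (fun x => (avg o F (brokenGrad v) x ⬝ᵥ normal o F) * jump o F u x))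
  + (∑ F : M.Face, (α₀ * (k : ℝ) ^ 2 / M.h) * faceIntegral F
      (fun x => jump o F u x * jump o F v x))

/-- The inverse of the affine map `F_T` with `F_T(ξ)_i = lo T i + (h / 2) (ξ_i + 1)` from the
reference element `[-1,1]^d` onto `T`. -/
def toReference (T : M.Elem) (x : Fin d → ℝ) : Fin d → ℝ :=
  fun i => 2 / M.h * (x i - M.lo T i) - 1

/-- The tensor-product Legendre polynomial `Ψ_T^σ` on the element `T`. -/
def tensorLegendre (T : M.Elem) (σ : Fin d → ℕ) (x : Fin d → ℝ) : ℝ :=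
  ∏ i, (legendre (σ i)).eval (M.toReference T x i)

/-- The index set of the hierarchical Legendre basis of the broken space of polynomials of
degree at most `k` in each variable. -/
abbrev BasisIndex (k : ℕ) : Type := M.Elem × (Fin d → Fin (k + 1))

/-- The basis function `Ψ_T^σ`, extended by zero to the other elements. -/
def basisFun (k : ℕ) (p : M.BasisIndex k) : M.Elem → (Fin d → ℝ) → ℝ :=
  Pi.single p.1 (M.tensorLegendre p.1 (fun i => (p.2 i : ℕ)))

/-- The stiffness matrix of the symmetric interior penalty discretization of degree `k`
in the hierarchical Legendre basis. -/
def stiffness (o : M.InteriorFace → Bool) (α₀ : ℝ) (k : ℕ) :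
    Matrix (M.BasisIndex k) (M.BasisIndex k) ℝ :=
  Matrix.of fun p q => M.form o α₀ k (M.basisFun k p) (M.basisFun k q)

/-- The diagonal part of the stiffness matrix. -/
def stiffnessDiag (o : M.InteriorFace → Bool) (α₀ : ℝ) (k : ℕ) :
    Matrix (M.BasisIndex k) (M.BasisIndex k) ℝ :=
  Matrix.diagonal (M.stiffness o α₀ k).diag

end UniformMesh

end SIPDG

end

noncomputable section

namespace SIPDG

open Polynomial MeasureTheory

/-! The spectral radius is at most the largest absolute row sum (Gershgorin), so it suffices to show
that every row of the stiffness matrix satisfies `∑ q, |A p q| ≤ C (k + 1) A p p`. Neither symmetry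
nor coercivity of the form on the whole space is needed.

Row sums and diagonal are compared through one quantity: `k² / h` times the sum, over the faces `F`
of the element of `p`, of the tangential mass `faceGram` of the basis function. For degrees at most
`k`, a Legendre polynomial has modulus 1 at `±1`, its derivative there is at most `k²`, and `|∫ lₙ'
lₘ'| ≤ 2k²`. Hence every volume, flux and penalty contribution is at most a constant times `k² / h`
times a tangential Gram entry (`abs_stiffness_le`). By orthogonality that entry vanishes unless the
two multi-indices agree in all tangential directions. Only the normal degree is free, which gives
the factor `k + 1` (`sum_faceGram_le`), and a face meets at most two elements.

On the diagonal the squared jump has endpoint factor exactly 1, so the penalty contributes `α₀ k² /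
h` times the same tangential mass. The two flux terms cost at most `4 k² / h` times it, and the
volume term is nonnegative (`le_stiffness_self`). For large `α₀` the diagonal dominates and `k² / h`
cancels. -/

/-! ### Legendre polynomials at the endpoints -/

/-- Leibniz' rule for the `m`-th derivative of `(X - c) ^ n * q` at the point `c`, `m ≥ n`. -/
theorem eval_iterate_derivative_X_sub_C_pow_mul (c : ℝ) (q : ℝ[X]) {n m : ℕ} (h : n ≤ m) :
    (derivative^[m] ((X - C c) ^ n * q)).eval c =
      (m.choose n : ℝ) * n.factorial * (derivative^[m - n] q).eval c := by
  -- At `c` only the term with exactly `n` derivatives on `(X - c) ^ n` survives: fewer leave a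
  -- vanishing factor, more annihilate it.
  rw [iterate_derivative_mul, eval_finsetSum, Finset.sum_eq_single (m - n)]
  · rw [iterate_derivative_X_sub_pow, Nat.sub_sub_self h, Nat.choose_symm h]
    simp [Nat.descFactorial_self, mul_assoc]
  · intro k hk hne
    rw [iterate_derivative_X_sub_pow]
    have hk' : k ≤ m := Nat.lt_succ_iff.mp (Finset.mem_range.mp hk)
    rcases lt_or_ge n (m - k) with h1 | h1
    · simp [Nat.descFactorial_eq_zero_iff_lt.mpr h1]
    · have : n - (m - k) ≠ 0 := by omega
      simp [this]
  · intro h'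
    exact absurd (Finset.mem_range.mpr (by omega)) h'

theorem eval_iterate_derivative_X_sub_C_pow_mul_of_lt (c : ℝ) (q : ℝ[X]) {n m : ℕ} (h : m < n) :
    (derivative^[m] ((X - C c) ^ n * q)).eval c = 0 := by
  rw [iterate_derivative_mul, eval_finsetSum]
  refine Finset.sum_eq_zero fun k _ => ?_
  rw [iterate_derivative_X_sub_pow]
  have : n - (m - k) ≠ 0 := by omega
  simp [this]

theorem X_sq_sub_one_pow_eq {ε : ℝ} (hε : ε ^ 2 = 1) (n : ℕ) :
    ((X : ℝ[X]) ^ 2 - 1) ^ n = (X - C ε) ^ n * (X + C ε) ^ n := by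
  rw [← mul_pow]
  congr 1
  have : (1 : ℝ[X]) = C ε ^ 2 := by rw [← C_pow, hε, C_1]
  rw [this]; ring

/-- In Rodrigues' formula all `n` derivatives must hit `(X - ε) ^ n`, leaving `n! (2ε)ⁿ`. The
hypothesis `ε ^ 2 = 1` treats both endpoints at once. -/
theorem legendre_eval_endpoint {ε : ℝ} (hε : ε ^ 2 = 1) (n : ℕ) :
    (legendre n).eval ε = ε ^ n := by
  rw [legendre, eval_mul, eval_C, X_sq_sub_one_pow_eq hε,
    eval_iterate_derivative_X_sub_C_pow_mul _ _ le_rfl]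
  have : (n.factorial : ℝ) ≠ 0 := by positivity
  simp only [Nat.choose_self, Nat.sub_self, Function.iterate_zero, id, eval_pow, eval_add, eval_X,
    eval_C, Nat.cast_one, one_mul]
  rw [← two_mul, mul_pow]
  field_simp

theorem abs_eq_one_of_sq_eq_one {ε : ℝ} (hε : ε ^ 2 = 1) : |ε| = 1 :=
  (pow_eq_one_iff_of_nonneg (abs_nonneg ε) two_ne_zero).mp (by rw [sq_abs, hε])

theorem abs_legendre_eval_endpoint {ε : ℝ} (hε : ε ^ 2 = 1) (n : ℕ) :
    |(legendre n).eval ε| = 1 := by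
  rw [legendre_eval_endpoint hε, abs_pow, abs_eq_one_of_sq_eq_one hε, one_pow]

/-- With `n + 1` derivatives, one is left over for `(X + ε) ^ n`. The truncated exponent `n - 1` is
harmless, since the factor `n` vanishes at `n = 0`. -/
theorem legendre_derivative_eval_endpoint {ε : ℝ} (hε : ε ^ 2 = 1) (n : ℕ) :
    (derivative (legendre n)).eval ε * 2 = n * (n + 1) * ε ^ (n - 1) := by
  rw [legendre, derivative_C_mul, ← Function.iterate_succ_apply' derivative, eval_mul, eval_C,
    X_sq_sub_one_pow_eq hε, eval_iterate_derivative_X_sub_C_pow_mul _ _ (Nat.le_succ n)]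
  have : (n.factorial : ℝ) ≠ 0 := by positivity
  rcases n with _ | n
  · simp
  · have h1 : n + 1 + 1 - (n + 1) = 1 := by omega
    rw [Nat.succ_eq_add_one, h1, Function.iterate_one, derivative_pow]
    simp only [Nat.choose_succ_self_right, eval_mul, eval_C, eval_pow, eval_add, eval_X,
      derivative_add, derivative_X, derivative_C, eval_one, eval_zero, Nat.add_sub_cancel]
    rw [← two_mul, mul_pow]
    push_cast
    field_simp
    ring

theorem abs_legendre_derivative_eval_endpoint {ε : ℝ} (hε : ε ^ 2 = 1) (n : ℕ) :
    |(derivative (legendre n)).eval ε| = n * (n + 1) / 2 := by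
  have h := congrArg abs (legendre_derivative_eval_endpoint hε n)
  rw [abs_mul, abs_mul, abs_pow, abs_eq_one_of_sq_eq_one hε, one_pow, mul_one,
    abs_of_pos (two_pos : (0 : ℝ) < 2),
    abs_of_nonneg (by positivity : (0 : ℝ) ≤ n * (n + 1))] at h
  linarith

theorem abs_legendre_derivative_eval_endpoint_le {ε : ℝ} (hε : ε ^ 2 = 1) {n k : ℕ} (hn : n ≤ k) :
    |(derivative (legendre n)).eval ε| ≤ (k : ℝ) ^ 2 := by
  rw [abs_legendre_derivative_eval_endpoint hε]
  have h1 : (n : ℝ) ≤ k := by exact_mod_cast hn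
  rcases Nat.eq_zero_or_pos n with h | h
  · subst h; simp
  · have : (1 : ℝ) ≤ n := by exact_mod_cast h
    nlinarith

theorem natDegree_legendre_le (n : ℕ) : (legendre n).natDegree ≤ n := by
  refine (natDegree_C_mul_le _ _).trans ((natDegree_iterate_derivative _ _).trans ?_)
  have h1 : ((X : ℝ[X]) ^ 2 - 1).natDegree ≤ 2 :=
    (natDegree_sub_le _ _).trans (by simp)
  have h2 := natDegree_pow_le_of_le n h1
  omega

/-! ### Orthogonality and derivative integrals -/

/-- Integration by parts on `[-1, 1]` for polynomials. -/
theorem integral_mul_derivative_eval (p q : ℝ[X]) :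
    ∫ x in (-1 : ℝ)..1, p.eval x * (derivative q).eval x =
      p.eval 1 * q.eval 1 - p.eval (-1) * q.eval (-1)
        - ∫ x in (-1 : ℝ)..1, (derivative p).eval x * q.eval x :=
  intervalIntegral.integral_mul_deriv_eq_deriv_mul
    (fun x _ => p.hasDerivAt x) (fun x _ => q.hasDerivAt x)
    ((derivative p).continuous.intervalIntegrable _ _)
    ((derivative q).continuous.intervalIntegrable _ _)

/-- Each integration by parts moves one derivative onto `q`; the endpoint zeros of `w` remove the
boundary terms, and `q` is exhausted before `w`. -/
theorem integral_mul_iterate_derivative_eq_zero (w : ℝ[X]) (n : ℕ)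
    (h1 : ∀ m < n, (derivative^[m] w).eval 1 = 0)
    (h2 : ∀ m < n, (derivative^[m] w).eval (-1) = 0) (q : ℝ[X]) (hq : q.natDegree < n) :
    ∫ x in (-1 : ℝ)..1, q.eval x * (derivative^[n] w).eval x = 0 := by
  induction n generalizing q with
  | zero => omega
  | succ n ih =>
    rw [Function.iterate_succ_apply', integral_mul_derivative_eval, h1 n n.lt_succ_self,
      h2 n n.lt_succ_self]
    -- The degree of a constant does not drop under differentiation, so the induction hypothesis may
    -- not apply; but then the derivative is zero.
    rcases Nat.eq_zero_or_pos q.natDegree with h | h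
    · rw [natDegree_eq_zero.mp h |>.choose_spec.symm]
      simp
    · rw [ih (fun m hm => h1 m (by omega)) (fun m hm => h2 m (by omega)) (derivative q)
        (by have := natDegree_derivative_lt h.ne'; omega)]
      simp

theorem integral_mul_legendre_eq_zero {n : ℕ} (q : ℝ[X]) (hq : q.natDegree < n) :
    ∫ x in (-1 : ℝ)..1, q.eval x * (legendre n).eval x = 0 := by
  have h := integral_mul_iterate_derivative_eq_zero ((X ^ 2 - 1) ^ n) n
    (fun m hm => by
      rw [X_sq_sub_one_pow_eq (ε := 1) (by norm_num),
        eval_iterate_derivative_X_sub_C_pow_mul_of_lt _ _ hm])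
    (fun m hm => by
      rw [X_sq_sub_one_pow_eq (ε := -1) (by norm_num),
        eval_iterate_derivative_X_sub_C_pow_mul_of_lt _ _ hm]) q hq
  simp_rw [legendre, eval_mul, eval_C, mul_left_comm]
  rw [intervalIntegral.integral_const_mul, h, mul_zero]

theorem integral_legendre_mul_legendre {n m : ℕ} (h : n ≠ m) :
    ∫ x in (-1 : ℝ)..1, (legendre n * legendre m).eval x = 0 := by
  rcases lt_or_gt_of_ne h with h | h
  · simp_rw [eval_mul]
    exact integral_mul_legendre_eq_zero _ ((natDegree_legendre_le n).trans_lt h)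
  · simp_rw [mul_comm (legendre n), eval_mul]
    exact integral_mul_legendre_eq_zero _ ((natDegree_legendre_le m).trans_lt h)

theorem integral_legendre_sq_pos (n : ℕ) :
    0 < ∫ x in (-1 : ℝ)..1, (legendre n * legendre n).eval x := by
  refine intervalIntegral.integral_pos (by norm_num) (Polynomial.continuous _).continuousOn
    (fun x _ => ?_) ⟨1, by simp, ?_⟩
  · rw [eval_mul]; exact mul_self_nonneg _
  · rw [eval_mul, legendre_eval_endpoint (by norm_num)]; simp

/-- With the lower degree differentiated twice, integration by parts leaves an integral that
vanishes by orthogonality. Only two boundary terms remain, each at most `k²`. -/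
theorem abs_integral_legendre_derivative_le {n m k : ℕ} (hn : n ≤ k) (hm : m ≤ k) :
    |∫ x in (-1 : ℝ)..1, (derivative (legendre n) * derivative (legendre m)).eval x|
      ≤ 2 * (k : ℝ) ^ 2 := by
  wlog h : n ≤ m generalizing n m with H
  · rw [mul_comm]; exact H hm hn (by omega)
  simp_rw [eval_mul]
  rw [integral_mul_derivative_eval]
  have h0 : ∫ x in (-1 : ℝ)..1, (derivative (derivative (legendre n))).eval x
      * (legendre m).eval x = 0 := by
    rcases Nat.eq_zero_or_pos m with hm0 | hm0
    · obtain rfl : n = 0 := by omega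
      simp [legendre]
    · refine integral_mul_legendre_eq_zero _ ?_
      have a := natDegree_derivative_le (derivative (legendre n))
      have b := natDegree_derivative_le (legendre n)
      have c := natDegree_legendre_le n
      omega
  rw [h0, sub_zero]
  refine (abs_sub _ _).trans ?_
  rw [abs_mul, abs_mul, abs_legendre_eval_endpoint (by norm_num),
    abs_legendre_eval_endpoint (by norm_num)]
  have a := abs_legendre_derivative_eval_endpoint_le (ε := 1) (by norm_num) hn
  have b := abs_legendre_derivative_eval_endpoint_le (ε := -1) (by norm_num) hn
  linarith

/-! ### Tensor products on cells and tangential Gram entries -/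

/-- Fubini and an affine substitution in each variable. The index type is general so as to cover
cells and faces alike; an empty one gives point evaluation when `d = 1`. -/
theorem integral_Icc_prod_eval {ι : Type*} [Fintype ι] {h : ℝ} (hh : 0 < h) (a b : ι → ℝ)
    (hb : ∀ j, b j = a j + h) (q : ι → ℝ[X]) :
    ∫ y in Set.Icc a b, ∏ j, (q j).eval (2 / h * (y j - a j) - 1) =
      ∏ j, (h / 2 * ∫ t in (-1 : ℝ)..1, (q j).eval t) := by
  rw [← Set.pi_univ_Icc, volume_pi, Measure.restrict_pi_pi,
    integral_fintype_prod_eq_prod (f := fun j t => (q j).eval (2 / h * (t - a j) - 1))]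
  refine Finset.prod_congr rfl fun j _ => ?_
  rw [integral_Icc_eq_integral_Ioc, ← intervalIntegral.integral_of_le (by rw [hb]; linarith)]
  have h1 : ∀ t, (q j).eval (2 / h * (t - a j) - 1)
      = (fun s => (q j).eval s) (2 / h * t + (-(2 / h * a j) - 1)) := fun t => by
    simp only; congr 1; ring
  simp_rw [h1]
  rw [intervalIntegral.integral_comp_mul_add (fun s => (q j).eval s) (by positivity), smul_eq_mul,
    hb, inv_div]
  congr 2
  · ring
  · field_simp; ring

namespace UniformMesh

variable {d : ℕ} (M : UniformMesh d)

theorem hi_eq (T : M.Elem) (j : Fin d) : M.hi T j = M.lo T j + M.h := by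
  simp only [hi, lo]; ring

theorem toReference_apply (T : M.Elem) (x : Fin d → ℝ) (i : Fin d) :
    M.toReference T x i = 2 / M.h * (x i - M.lo T i) - 1 := rfl

theorem integral_cell_prod_eval (T : M.Elem) (q : Fin d → ℝ[X]) :
    ∫ x in M.cell T, ∏ j, (q j).eval (M.toReference T x j) =
      ∏ j, (M.h / 2 * ∫ t in (-1 : ℝ)..1, (q j).eval t) :=
  integral_Icc_prod_eval M.h_pos _ _ (M.hi_eq T) q

/-- The factors of the `i`-th partial derivative of a tensor-product Legendre polynomial. -/
def gradFactor (σ : Fin d → ℕ) (i : Fin d) : Fin d → ℝ[X] :=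
  Function.update (fun j => legendre (σ j)) i (derivative (legendre (σ i)))

theorem grad_tensorLegendre (T : M.Elem) (σ : Fin d → ℕ) (x : Fin d → ℝ) (i : Fin d) :
    grad (M.tensorLegendre T σ) x i =
      2 / M.h * ∏ j, (gradFactor σ i j).eval (M.toReference T x j) := by
  have hd : ∀ j ∈ (Finset.univ : Finset (Fin d)),
      HasFDerivAt (fun y : Fin d → ℝ => (legendre (σ j)).eval (M.toReference T y j))
        (((derivative (legendre (σ j))).eval (M.toReference T x j) * (2 / M.h)) •
          (ContinuousLinearMap.proj j : (Fin d → ℝ) →L[ℝ] ℝ)) x := by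
    intro j _
    have h1 : HasDerivAt (fun t : ℝ => (legendre (σ j)).eval (2 / M.h * (t - M.lo T j) - 1))
        ((derivative (legendre (σ j))).eval (M.toReference T x j) * (2 / M.h)) (x j) := by
      refine HasDerivAt.comp (x j) ((legendre (σ j)).hasDerivAt _) ?_
      simpa using (((hasDerivAt_id (x j)).sub_const (M.lo T j)).const_mul (2 / M.h)).sub_const 1
    exact h1.comp_hasFDerivAt x
      (ContinuousLinearMap.proj j : (Fin d → ℝ) →L[ℝ] ℝ).hasFDerivAt
  rw [grad]
  change fderiv ℝ (fun y => ∏ j, (legendre (σ j)).eval (M.toReference T y j)) x _ = _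
  rw [(HasFDerivAt.finsetProd hd).fderiv, sum_apply, Finset.sum_eq_single i]
  · rw [← Finset.mul_prod_erase _ _ (Finset.mem_univ i), gradFactor]
    have h2 : ∀ j ∈ Finset.univ.erase i,
        (Function.update (fun j => legendre (σ j)) i (derivative (legendre (σ i))) j).eval
          (M.toReference T x j) = (legendre (σ j)).eval (M.toReference T x j) := by
      intro j hj
      rw [Function.update_of_ne (Finset.ne_of_mem_erase hj)]
    rw [Finset.prod_congr rfl h2]
    simp
    ring
  · intro j _ hj
    simp [hj]
  · simp

/-- The Gram matrix of the tensor-product Legendre polynomials in the directions other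
than `i`. -/
def faceGram (i : Fin d) (σ τ : Fin d → ℕ) : ℝ :=
  ∏ j : {j : Fin d // j ≠ i}, (M.h / 2 * ∫ t in (-1 : ℝ)..1,
    (legendre (σ j) * legendre (τ j)).eval t)

theorem faceGram_comm (i : Fin d) (σ τ : Fin d → ℕ) : M.faceGram i σ τ = M.faceGram i τ σ := by
  exact Finset.prod_congr rfl fun j _ => by rw [mul_comm (legendre (σ j))]

theorem faceGram_self_pos (i : Fin d) (σ : Fin d → ℕ) : 0 < M.faceGram i σ σ :=
  Finset.prod_pos fun _ _ => mul_pos (half_pos M.h_pos) (integral_legendre_sq_pos _)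

theorem faceGram_eq_zero {i j : Fin d} {σ τ : Fin d → ℕ} (hj : j ≠ i) (h : σ j ≠ τ j) :
    M.faceGram i σ τ = 0 :=
  Finset.prod_eq_zero (Finset.mem_univ ⟨j, hj⟩)
    (by simp only [integral_legendre_mul_legendre h, mul_zero])

theorem faceGram_of_eq {i : Fin d} {σ τ : Fin d → ℕ} (h : ∀ j, j ≠ i → σ j = τ j) :
    M.faceGram i σ τ = M.faceGram i σ σ := by
  simp only [faceGram]
  exact Finset.prod_congr rfl fun j _ => by rw [h j j.2]

theorem faceGram_nonneg (i : Fin d) (σ τ : Fin d → ℕ) : 0 ≤ M.faceGram i σ τ := by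
  by_cases h : ∀ j, j ≠ i → σ j = τ j
  · rw [M.faceGram_of_eq h]; exact (M.faceGram_self_pos i σ).le
  · push Not at h
    obtain ⟨j, hj, hne⟩ := h
    exact (M.faceGram_eq_zero hj hne).ge

/-- The source of the factor `k + 1`: orthogonality fixes `τ` away from `i`, so `τ` is determined by
`τ i`. -/
theorem sum_faceGram_le (k : ℕ) (i : Fin d) (σ : Fin d → ℕ) :
    ∑ τ : Fin d → Fin (k + 1), M.faceGram i σ (fun j => (τ j : ℕ)) ≤
      ((k : ℝ) + 1) * M.faceGram i σ σ := by
  classical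
  set s : Finset (Fin d → Fin (k + 1)) :=
    Finset.univ.filter fun τ => ∀ j, j ≠ i → σ j = τ j with hs
  have hcard : s.card ≤ k + 1 := by
    have := Finset.card_le_card_of_injOn (s := s) (t := (Finset.univ : Finset (Fin (k + 1))))
      (fun τ => τ i) (fun _ _ => Finset.mem_univ _) (by
        intro τ hτ τ' hτ' he
        have h1 := (Finset.mem_filter.mp (Finset.mem_coe.mp hτ)).2
        have h2 := (Finset.mem_filter.mp (Finset.mem_coe.mp hτ')).2
        funext j
        by_cases hj : j = i
        · subst hj; exact he
        · exact Fin.ext ((h1 j hj).symm.trans (h2 j hj)))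
    simpa using this
  calc ∑ τ : Fin d → Fin (k + 1), M.faceGram i σ (fun j => (τ j : ℕ))
      = ∑ τ ∈ s, M.faceGram i σ (fun j => (τ j : ℕ)) := by
        refine (Finset.sum_subset (Finset.subset_univ s) fun τ _ hτ => ?_).symm
        have : ¬ ∀ j, j ≠ i → σ j = τ j := fun h => hτ (by simpa [hs] using h)
        push Not at this
        obtain ⟨j, hj, hne⟩ := this
        exact M.faceGram_eq_zero hj hne
    _ = ∑ τ ∈ s, M.faceGram i σ σ := Finset.sum_congr rfl fun τ hτ =>
        M.faceGram_of_eq (Finset.mem_filter.mp hτ).2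
    _ = s.card * M.faceGram i σ σ := by rw [Finset.sum_const, nsmul_eq_mul]
    _ ≤ ((k : ℝ) + 1) * M.faceGram i σ σ := by
        have := (M.faceGram_self_pos i σ).le
        gcongr
        exact_mod_cast hcard

theorem integrableOn_prod_eval (T : M.Elem) (q : Fin d → ℝ[X]) :
    IntegrableOn (fun x => ∏ j, (q j).eval (M.toReference T x j)) (M.cell T) := by
  refine ContinuousOn.integrableOn_compact isCompact_Icc (Continuous.continuousOn ?_)
  refine continuous_finsetProd _ fun j _ => (q j).continuous.comp ?_
  simp only [toReference]
  fun_prop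

/-- The factor `2 / h` combines `(2 / h)²` from the chain rule with `h / 2` from integrating in
direction `i`. -/
theorem integral_cell_grad_dotProduct_grad (T : M.Elem) (σ τ : Fin d → ℕ) :
    ∫ x in M.cell T, grad (M.tensorLegendre T σ) x ⬝ᵥ grad (M.tensorLegendre T τ) x =
      ∑ i, 2 / M.h * (∫ t in (-1 : ℝ)..1,
        (derivative (legendre (σ i)) * derivative (legendre (τ i))).eval t) *
          M.faceGram i σ τ := by
  have h1 : ∀ x, grad (M.tensorLegendre T σ) x ⬝ᵥ grad (M.tensorLegendre T τ) x =
      ∑ i, (2 / M.h) ^ 2 *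
        ∏ j, (gradFactor σ i j * gradFactor τ i j).eval (M.toReference T x j) := by
    intro x
    refine Finset.sum_congr rfl fun i _ => ?_
    simp only [grad_tensorLegendre, eval_mul, Finset.prod_mul_distrib]
    ring
  simp_rw [h1]
  rw [integral_finsetSum _ fun i _ =>
    (M.integrableOn_prod_eval T fun j => gradFactor σ i j * gradFactor τ i j).const_mul _]
  refine Finset.sum_congr rfl fun i _ => ?_
  rw [integral_const_mul, M.integral_cell_prod_eval T fun j => gradFactor σ i j * gradFactor τ i j,
    Fintype.prod_eq_mul_prod_subtype_ne _ i]
  have h2 : ∀ j : {j // j ≠ i}, gradFactor σ i j * gradFactor τ i j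
      = legendre (σ j) * legendre (τ j) := fun j => by
    simp only [gradFactor, Function.update_of_ne j.2]
  simp_rw [h2]
  have h3 := M.h_pos.ne'
  simp only [gradFactor, Function.update_self, faceGram]
  field_simp

variable {M}

/-! ### Face geometry and face integrals -/

/-- The coordinate direction orthogonal to a face. -/
def faceDir : M.Face → Fin d
  | Sum.inl F => F.1.1
  | Sum.inr F => F.1.1

/-- The element in terms of which a face is described. -/
def baseElem : M.Face → M.Elem
  | Sum.inl F => F.1.2
  | Sum.inr F => F.1.2.2

/-- The coordinate of the hyperplane which contains a face. -/
def facePos : M.Face → ℝ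
  | Sum.inl F => M.hi F.1.2 F.1.1
  | Sum.inr F => if F.1.2.1 = true then M.hi F.1.2.2 F.1.1 else M.lo F.1.2.2 F.1.1

/-- The elements adjacent to a face. -/
def adjElems : M.Face → Finset M.Elem
  | Sum.inl F => {lowerElem F, upperElem F}
  | Sum.inr F => {F.1.2.2}

/-- The reference coordinate, in the direction orthogonal to the face `F`, of the points of `F`
seen from the element `T`. -/
def endpoint (F : M.Face) (T : M.Elem) : ℝ :=
  2 / M.h * (facePos F - M.lo T (faceDir F)) - 1

theorem card_adjElems_le (F : M.Face) : (adjElems F).card ≤ 2 := by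
  rcases F with F | F
  · exact Finset.card_le_two
  · simp [adjElems]

/-- Both neighbours of a face thus share its tangential reference coordinates, so face integrals
across elements factor as those on a single element. -/
theorem lo_eq_of_mem_adjElems {F : M.Face} {T : M.Elem} (hT : T ∈ adjElems F) {j : Fin d}
    (hj : j ≠ faceDir F) : M.lo T j = M.lo (baseElem F) j := by
  rcases F with F | F
  · rcases Finset.mem_insert.mp hT with rfl | h
    · rfl
    · rw [Finset.mem_singleton.mp h]
      have hj' : j ≠ F.1.1 := hj
      simp only [lo, upperElem, baseElem, Function.update_of_ne hj']
  · rw [Finset.mem_singleton.mp hT]; rfl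

theorem endpoint_sq {F : M.Face} {T : M.Elem} (hT : T ∈ adjElems F) :
    endpoint F T ^ 2 = 1 := by
  have h0 := M.h_pos.ne'
  rcases F with F | F
  · rcases Finset.mem_insert.mp hT with rfl | h
    · simp only [endpoint, facePos, faceDir, lowerElem, hi_eq]
      field_simp
      ring
    · rw [Finset.mem_singleton.mp h]
      simp only [endpoint, facePos, faceDir, upperElem, hi, lo, Function.update_self]
      push_cast
      simp
  · rw [Finset.mem_singleton.mp hT]
    simp only [endpoint, facePos, faceDir]
    split_ifs
    · rw [hi_eq]
      field_simp
      ring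
    · simp

theorem faceIntegral_eq (F : M.Face) (g : (Fin d → ℝ) → ℝ) :
    faceIntegral F g =
      ∫ y in Set.Icc (fun j : {j : Fin d // j ≠ faceDir F} => M.lo (baseElem F) j)
        (fun j => M.hi (baseElem F) j), g (facePoint (faceDir F) (facePos F) y) := by
  rcases F with F | F <;> rfl

theorem faceIntegral_const_mul (F : M.Face) (c : ℝ) (g : (Fin d → ℝ) → ℝ) :
    faceIntegral F (fun x => c * g x) = c * faceIntegral F g := by
  rw [faceIntegral_eq, faceIntegral_eq, integral_const_mul]

theorem prod_eval_toReference_facePoint {F : M.Face} {T : M.Elem} (hT : T ∈ adjElems F)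
    (q : Fin d → ℝ[X]) (y : {j : Fin d // j ≠ faceDir F} → ℝ) :
    ∏ j, (q j).eval (M.toReference T (facePoint (faceDir F) (facePos F) y) j) =
      (q (faceDir F)).eval (endpoint F T) * ∏ j : {j : Fin d // j ≠ faceDir F},
        (q j).eval (2 / M.h * (y j - M.lo (baseElem F) j) - 1) := by
  rw [Fintype.prod_eq_mul_prod_subtype_ne _ (faceDir F)]
  congr 1
  · simp [toReference, facePoint, endpoint]
  · refine Finset.prod_congr rfl fun j _ => ?_
    rw [toReference_apply, lo_eq_of_mem_adjElems hT j.2, facePoint, dif_neg j.2]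

theorem faceIntegral_prod_eval_mul_prod_eval {F : M.Face} {T T' : M.Elem} (hT : T ∈ adjElems F)
    (hT' : T' ∈ adjElems F) (q r : Fin d → ℝ[X]) :
    faceIntegral F (fun x => (∏ j, (q j).eval (M.toReference T x j)) *
        ∏ j, (r j).eval (M.toReference T' x j)) =
      (q (faceDir F)).eval (endpoint F T) * (r (faceDir F)).eval (endpoint F T') *
        ∏ j : {j : Fin d // j ≠ faceDir F},
          (M.h / 2 * ∫ t in (-1 : ℝ)..1, (q j * r j).eval t) := by
  rw [faceIntegral_eq]
  simp_rw [prod_eval_toReference_facePoint hT, prod_eval_toReference_facePoint hT']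
  rw [← integral_Icc_prod_eval M.h_pos _ _ (fun j : {j : Fin d // j ≠ faceDir F} =>
    M.hi_eq (baseElem F) j) (fun j => q j * r j), ← integral_const_mul]
  congr 1
  funext y
  simp only [eval_mul, Finset.prod_mul_distrib]
  ring

theorem faceIntegral_tensorLegendre_mul {F : M.Face} {T T' : M.Elem} (hT : T ∈ adjElems F)
    (hT' : T' ∈ adjElems F) (σ τ : Fin d → ℕ) :
    faceIntegral F (fun x => M.tensorLegendre T σ x * M.tensorLegendre T' τ x) =
      (legendre (σ (faceDir F))).eval (endpoint F T) *
        (legendre (τ (faceDir F))).eval (endpoint F T') * M.faceGram (faceDir F) σ τ :=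
  faceIntegral_prod_eval_mul_prod_eval hT hT' (fun j => legendre (σ j)) (fun j => legendre (τ j))

theorem faceIntegral_grad_tensorLegendre_mul {F : M.Face} {T T' : M.Elem} (hT : T ∈ adjElems F)
    (hT' : T' ∈ adjElems F) (σ τ : Fin d → ℕ) :
    faceIntegral F
        (fun x => grad (M.tensorLegendre T σ) x (faceDir F) * M.tensorLegendre T' τ x) =
      2 / M.h * ((derivative (legendre (σ (faceDir F)))).eval (endpoint F T) *
        (legendre (τ (faceDir F))).eval (endpoint F T') * M.faceGram (faceDir F) σ τ) := by
  simp_rw [grad_tensorLegendre, tensorLegendre, mul_assoc (2 / M.h)]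
  rw [faceIntegral_const_mul, faceIntegral_prod_eval_mul_prod_eval hT hT' _
    (fun j => legendre (τ j))]
  have h2 : ∀ j : {j // j ≠ faceDir F}, gradFactor σ (faceDir F) j = legendre (σ j) := fun j => by
    simp only [gradFactor, Function.update_of_ne j.2]
  simp_rw [h2]
  simp only [gradFactor, Function.update_self, faceGram]

/-! ### Jumps and fluxes of basis functions -/

/-- The jump on `F` of a function supported on `T`, relative to its value. -/
def jumpCoeff (o : M.InteriorFace → Bool) (F : M.Face) (T : M.Elem) : ℝ :=
  match F with
  | Sum.inl F => (if firstElem o F = T then 1 else 0) - (if secondElem o F = T then 1 else 0)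
  | Sum.inr F => if F.1.2.2 = T then 1 else 0

/-- The average normal derivative on `F` of a function supported on `T`, relative to its
derivative in the coordinate direction orthogonal to `F`. -/
def fluxCoeff (o : M.InteriorFace → Bool) (F : M.Face) (T : M.Elem) : ℝ :=
  match F with
  | Sum.inl F =>
      (1 / 2 * (if firstElem o F = T then 1 else 0) +
        1 / 2 * (if secondElem o F = T then 1 else 0)) * (if o F = true then 1 else -1)
  | Sum.inr F => (if F.1.2.2 = T then 1 else 0) * (if F.1.2.1 = true then 1 else -1)

/-- The multi-index of a basis function, with natural number entries. -/
def degrees {k : ℕ} (p : M.BasisIndex k) : Fin d → ℕ := fun i => (p.2 i : ℕ)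

theorem basisFun_apply (k : ℕ) (p : M.BasisIndex k) (T : M.Elem) (x : Fin d → ℝ) :
    M.basisFun k p T x =
      (if T = p.1 then 1 else 0) * M.tensorLegendre p.1 (degrees p) x := by
  rw [basisFun, Pi.single_apply]
  unfold degrees
  split_ifs <;> simp

theorem grad_basisFun (k : ℕ) (p : M.BasisIndex k) (T : M.Elem) (x : Fin d → ℝ) (i : Fin d) :
    grad (M.basisFun k p T) x i =
      (if T = p.1 then 1 else 0) * grad (M.tensorLegendre p.1 (degrees p)) x i := by
  rw [basisFun, Pi.single_apply]
  unfold degrees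
  split_ifs
  · simp
  · simp [grad]

theorem jump_basisFun (o : M.InteriorFace → Bool) (F : M.Face) (k : ℕ) (p : M.BasisIndex k)
    (x : Fin d → ℝ) :
    jump o F (M.basisFun k p) x =
      jumpCoeff o F p.1 * M.tensorLegendre p.1 (degrees p) x := by
  rcases F with F | F
  · simp only [jump, jumpCoeff, basisFun_apply]
    ring
  · simp only [jump, jumpCoeff, basisFun_apply]

theorem avg_brokenGrad_basisFun (o : M.InteriorFace → Bool) (F : M.Face) (k : ℕ)
    (p : M.BasisIndex k) (x : Fin d → ℝ) :
    avg o F (brokenGrad (M.basisFun k p)) x ⬝ᵥ normal o F =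
      fluxCoeff o F p.1 * grad (M.tensorLegendre p.1 (degrees p)) x (faceDir F) := by
  rcases F with F | F
  · simp only [avg, normal, brokenGrad, dotProduct_single, Pi.add_apply, Pi.smul_apply,
      smul_eq_mul, grad_basisFun, fluxCoeff, faceDir]
    ring
  · simp only [avg, normal, brokenGrad, dotProduct_single, grad_basisFun, fluxCoeff, faceDir]
    ring

theorem firstElem_mem_adjElems (o : M.InteriorFace → Bool) (F : M.InteriorFace) :
    firstElem o F ∈ adjElems (Sum.inl F) := by
  simp only [firstElem, adjElems]
  split_ifs <;> simp

theorem secondElem_mem_adjElems (o : M.InteriorFace → Bool) (F : M.InteriorFace) :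
    secondElem o F ∈ adjElems (Sum.inl F) := by
  simp only [secondElem, adjElems]
  split_ifs <;> simp

theorem jumpCoeff_eq_zero (o : M.InteriorFace → Bool) {F : M.Face} {T : M.Elem}
    (hT : T ∉ adjElems F) : jumpCoeff o F T = 0 := by
  rcases F with F | F
  · have h1 : firstElem o F ≠ T := fun h => hT (h ▸ firstElem_mem_adjElems o F)
    have h2 : secondElem o F ≠ T := fun h => hT (h ▸ secondElem_mem_adjElems o F)
    simp [jumpCoeff, h1, h2]
  · have h1 : F.1.2.2 ≠ T := fun h => hT (by simp [adjElems, h])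
    simp [jumpCoeff, h1]

theorem fluxCoeff_eq_zero (o : M.InteriorFace → Bool) {F : M.Face} {T : M.Elem}
    (hT : T ∉ adjElems F) : fluxCoeff o F T = 0 := by
  rcases F with F | F
  · have h1 : firstElem o F ≠ T := fun h => hT (h ▸ firstElem_mem_adjElems o F)
    have h2 : secondElem o F ≠ T := fun h => hT (h ▸ secondElem_mem_adjElems o F)
    simp [fluxCoeff, h1, h2]
  · have h1 : F.1.2.2 ≠ T := fun h => hT (by simp [adjElems, h])
    simp [fluxCoeff, h1]

theorem lowerElem_ne_upperElem (F : M.InteriorFace) : lowerElem F ≠ upperElem F := by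
  intro h
  have := congrArg Fin.val (congrFun h F.1.1)
  simp [lowerElem, upperElem] at this

theorem jumpCoeff_sq (o : M.InteriorFace → Bool) {F : M.Face} {T : M.Elem}
    (hT : T ∈ adjElems F) : jumpCoeff o F T ^ 2 = 1 := by
  rcases F with F | F
  · have h0 := lowerElem_ne_upperElem F
    rcases Finset.mem_insert.mp hT with rfl | h
    · by_cases ho : o F = true <;> simp [jumpCoeff, firstElem, secondElem, ho, h0.symm]
    · rw [Finset.mem_singleton.mp h]
      by_cases ho : o F = true <;> simp [jumpCoeff, firstElem, secondElem, ho, h0]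
  · rw [Finset.mem_singleton.mp hT]
    simp [jumpCoeff]

theorem abs_fluxCoeff_le (o : M.InteriorFace → Bool) (F : M.Face) (T : M.Elem) :
    |fluxCoeff o F T| ≤ 1 := by
  rcases F with F | F <;> simp only [fluxCoeff] <;> split_ifs <;> norm_num

theorem abs_jumpCoeff_le (o : M.InteriorFace → Bool) (F : M.Face) (T : M.Elem) :
    |jumpCoeff o F T| ≤ 1 := by
  rcases F with F | F <;> simp only [jumpCoeff] <;> split_ifs <;> norm_num

/-- The indicator of adjacency of an element to a face. -/
def adjInd (F : M.Face) (T : M.Elem) : ℝ := if T ∈ adjElems F then 1 else 0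

theorem adjInd_nonneg (F : M.Face) (T : M.Elem) : 0 ≤ adjInd F T := by
  unfold adjInd; split_ifs <;> norm_num

theorem degrees_le {k : ℕ} (p : M.BasisIndex k) (i : Fin d) : degrees p i ≤ k :=
  Nat.lt_succ_iff.mp (p.2 i).2

/-! ### Bounds on the matrix entries -/

theorem faceIntegral_flux_mul_jump (o : M.InteriorFace → Bool) (F : M.Face) {k : ℕ}
    (p q : M.BasisIndex k) :
    faceIntegral F (fun x => (avg o F (brokenGrad (M.basisFun k p)) x ⬝ᵥ normal o F) *
        jump o F (M.basisFun k q) x) =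
      fluxCoeff o F p.1 * jumpCoeff o F q.1 * faceIntegral F (fun x =>
        grad (M.tensorLegendre p.1 (degrees p)) x (faceDir F) *
          M.tensorLegendre q.1 (degrees q) x) := by
  rw [← faceIntegral_const_mul]
  congr 1
  funext x
  rw [avg_brokenGrad_basisFun, jump_basisFun]
  ring

theorem faceIntegral_jump_mul_jump (o : M.InteriorFace → Bool) (F : M.Face) {k : ℕ}
    (p q : M.BasisIndex k) :
    faceIntegral F (fun x => jump o F (M.basisFun k p) x * jump o F (M.basisFun k q) x) =
      jumpCoeff o F p.1 * jumpCoeff o F q.1 * faceIntegral F (fun x =>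
        M.tensorLegendre p.1 (degrees p) x * M.tensorLegendre q.1 (degrees q) x) := by
  rw [← faceIntegral_const_mul]
  congr 1
  funext x
  rw [jump_basisFun, jump_basisFun]
  ring

/-- The 2 is the chain-rule factor in `2 / h`, and `k²` bounds the endpoint derivative; the
coefficients, signs included, are bounded by 1. -/
theorem abs_faceIntegral_flux_mul_jump_le (o : M.InteriorFace → Bool) (F : M.Face) {k : ℕ}
    (p q : M.BasisIndex k) :
    |faceIntegral F (fun x => (avg o F (brokenGrad (M.basisFun k p)) x ⬝ᵥ normal o F) *
        jump o F (M.basisFun k q) x)| ≤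
      adjInd F p.1 * adjInd F q.1 *
        (2 * ((k : ℝ) ^ 2 / M.h) * M.faceGram (faceDir F) (degrees p) (degrees q)) := by
  rw [faceIntegral_flux_mul_jump]
  by_cases hp : p.1 ∈ adjElems F
  swap
  · simp [fluxCoeff_eq_zero o hp, adjInd, hp]
  by_cases hq : q.1 ∈ adjElems F
  swap
  · simp [jumpCoeff_eq_zero o hq, adjInd, hq]
  have hG := M.faceGram_nonneg (faceDir F) (degrees p) (degrees q)
  have hh := M.h_pos
  rw [faceIntegral_grad_tensorLegendre_mul hp hq]
  simp only [abs_mul, abs_legendre_eval_endpoint (endpoint_sq hq), abs_of_nonneg hG]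
  rw [abs_of_pos (show 0 < 2 / M.h by positivity)]
  have h1 := abs_legendre_derivative_eval_endpoint_le (endpoint_sq hp)
    (degrees_le p (faceDir F))
  calc _ ≤ 1 * 1 * (2 / M.h * ((k : ℝ) ^ 2 * 1 *
        M.faceGram (faceDir F) (degrees p) (degrees q))) := by
        gcongr
        · exact abs_fluxCoeff_le o F _
        · exact abs_jumpCoeff_le o F _
    _ = _ := by simp only [adjInd, hp, hq, if_true]; ring

theorem abs_faceIntegral_jump_mul_jump_le (o : M.InteriorFace → Bool) (F : M.Face) {k : ℕ}
    (p q : M.BasisIndex k) :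
    |faceIntegral F (fun x => jump o F (M.basisFun k p) x * jump o F (M.basisFun k q) x)| ≤
      adjInd F p.1 * adjInd F q.1 * M.faceGram (faceDir F) (degrees p) (degrees q) := by
  rw [faceIntegral_jump_mul_jump]
  by_cases hp : p.1 ∈ adjElems F
  swap
  · simp [jumpCoeff_eq_zero o hp, adjInd, hp]
  by_cases hq : q.1 ∈ adjElems F
  swap
  · simp [jumpCoeff_eq_zero o hq, adjInd, hq]
  have hG := M.faceGram_nonneg (faceDir F) (degrees p) (degrees q)
  rw [faceIntegral_tensorLegendre_mul hp hq]
  simp only [abs_mul, abs_legendre_eval_endpoint (endpoint_sq hq),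
    abs_legendre_eval_endpoint (endpoint_sq hp), abs_of_nonneg hG]
  calc _ ≤ 1 * 1 * (1 * 1 * M.faceGram (faceDir F) (degrees p) (degrees q)) := by
        gcongr
        · exact abs_jumpCoeff_le o F _
        · exact abs_jumpCoeff_le o F _
    _ = _ := by simp only [adjInd, hp, hq, if_true]; ring

/-- Equality, not just a bound, holds because jump coefficients and endpoint values are `±1`. This
yields the lower bound on the diagonal. -/
theorem faceIntegral_jump_mul_jump_self (o : M.InteriorFace → Bool) (F : M.Face) {k : ℕ}
    (p : M.BasisIndex k) :
    faceIntegral F (fun x => jump o F (M.basisFun k p) x * jump o F (M.basisFun k p) x) =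
      adjInd F p.1 * M.faceGram (faceDir F) (degrees p) (degrees p) := by
  rw [faceIntegral_jump_mul_jump]
  by_cases hp : p.1 ∈ adjElems F
  swap
  · simp [jumpCoeff_eq_zero o hp, adjInd, hp]
  rw [faceIntegral_tensorLegendre_mul hp hp, ← sq, ← sq, jumpCoeff_sq o hp, ← sq_abs (eval _ _),
    abs_legendre_eval_endpoint (endpoint_sq hp)]
  simp [adjInd, hp]

theorem abs_sum_integral_grad_le {k : ℕ} (p q : M.BasisIndex k) :
    |∑ T : M.Elem, ∫ x in M.cell T, grad (M.basisFun k p T) x ⬝ᵥ grad (M.basisFun k q T) x| ≤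
      (if q.1 = p.1 then 1 else 0) * ∑ i, 4 * ((k : ℝ) ^ 2 / M.h) *
        M.faceGram i (degrees p) (degrees q) := by
  have hh := M.h_pos
  have h1 : ∀ T x, grad (M.basisFun k p T) x ⬝ᵥ grad (M.basisFun k q T) x =
      ((if T = p.1 then 1 else 0) * (if T = q.1 then 1 else 0)) *
        (grad (M.tensorLegendre p.1 (degrees p)) x ⬝ᵥ
          grad (M.tensorLegendre q.1 (degrees q)) x) := by
    intro T x
    simp only [dotProduct, grad_basisFun, Finset.mul_sum]
    exact Finset.sum_congr rfl fun i _ => by ring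
  simp_rw [h1, integral_const_mul]
  rw [Finset.sum_eq_single p.1 (fun T _ hT => by simp [hT]) (by simp)]
  by_cases hpq : q.1 = p.1
  · rw [hpq]
    simp only [if_true, one_mul]
    rw [M.integral_cell_grad_dotProduct_grad]
    refine (Finset.abs_sum_le_sum_abs _ _).trans (Finset.sum_le_sum fun i _ => ?_)
    have hG := M.faceGram_nonneg i (degrees p) (degrees q)
    rw [abs_mul, abs_mul, abs_of_nonneg hG, abs_of_pos (show 0 < 2 / M.h by positivity)]
    have h2 := abs_integral_legendre_derivative_le (degrees_le p i) (degrees_le q i)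
    calc _ ≤ 2 / M.h * (2 * (k : ℝ) ^ 2) * M.faceGram i (degrees p) (degrees q) := by gcongr
      _ = _ := by ring
  · simp [hpq, Ne.symm hpq]

theorem sum_integral_grad_self_nonneg (u : M.Elem → (Fin d → ℝ) → ℝ) :
    0 ≤ ∑ T : M.Elem, ∫ x in M.cell T, grad (u T) x ⬝ᵥ grad (u T) x :=
  Finset.sum_nonneg fun _ _ => integral_nonneg fun _ =>
    Finset.sum_nonneg fun _ _ => mul_self_nonneg _

/-- In `4 + α₀` each of the two flux terms contributes 2 and the penalty `α₀`. -/
theorem abs_stiffness_le (o : M.InteriorFace → Bool) {α₀ : ℝ} (hα : 0 ≤ α₀) {k : ℕ}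
    (p q : M.BasisIndex k) :
    |M.stiffness o α₀ k p q| ≤
      (if q.1 = p.1 then 1 else 0) * (∑ i, 4 * ((k : ℝ) ^ 2 / M.h) *
        M.faceGram i (degrees p) (degrees q)) +
      ∑ F : M.Face, adjInd F p.1 * adjInd F q.1 *
        ((4 + α₀) * ((k : ℝ) ^ 2 / M.h) * M.faceGram (faceDir F) (degrees p) (degrees q)) := by
  have hh := M.h_pos
  simp only [stiffness, Matrix.of_apply, form]
  rw [sub_sub, sub_add, ← Finset.sum_add_distrib, ← Finset.sum_sub_distrib]
  refine (abs_sub _ _).trans (add_le_add (abs_sum_integral_grad_le p q)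
    ((Finset.abs_sum_le_sum_abs _ _).trans (Finset.sum_le_sum fun F _ => ?_)))
  have h1 := abs_faceIntegral_flux_mul_jump_le o F p q
  have h2 := abs_faceIntegral_flux_mul_jump_le o F q p
  have h3 := mul_le_mul_of_nonneg_left (abs_faceIntegral_jump_mul_jump_le o F p q)
    (show 0 ≤ α₀ * (k : ℝ) ^ 2 / M.h by positivity)
  rw [M.faceGram_comm _ (degrees q)] at h2
  rw [← abs_of_nonneg (show 0 ≤ α₀ * (k : ℝ) ^ 2 / M.h by positivity), ← abs_mul,
    abs_of_nonneg (show 0 ≤ α₀ * (k : ℝ) ^ 2 / M.h by positivity)] at h3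
  refine (abs_sub _ _).trans ((add_le_add ((abs_add_le _ _).trans (add_le_add h1 h2)) h3).trans
    (le_of_eq ?_))
  ring

/-- The nonnegative volume term is dropped, and the two flux terms consume `4` of the penalty
constant. -/
theorem le_stiffness_self (o : M.InteriorFace → Bool) (α₀ : ℝ) {k : ℕ} (p : M.BasisIndex k) :
    (α₀ - 4) * ((k : ℝ) ^ 2 / M.h) *
        ∑ F : M.Face, adjInd F p.1 * M.faceGram (faceDir F) (degrees p) (degrees p) ≤
      M.stiffness o α₀ k p p := by
  simp only [stiffness, Matrix.of_apply, form]
  have h0 := sum_integral_grad_self_nonneg (M.basisFun k p)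
  rw [sub_sub, sub_add, ← Finset.sum_add_distrib, ← Finset.sum_sub_distrib,
    Finset.mul_sum]
  rw [sub_eq_add_neg (∑ T : M.Elem, _), ← Finset.sum_neg_distrib]
  refine le_add_of_nonneg_of_le h0 (Finset.sum_le_sum fun F _ => ?_)
  rw [faceIntegral_jump_mul_jump_self]
  have h1 := (le_abs_self _).trans (abs_faceIntegral_flux_mul_jump_le o F p p)
  have h2 : adjInd F p.1 * adjInd F p.1 = adjInd F p.1 := by
    unfold adjInd; split_ifs <;> simp
  rw [h2] at h1
  have h3 : α₀ * (k : ℝ) ^ 2 / M.h = α₀ * ((k : ℝ) ^ 2 / M.h) := by ring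
  rw [h3]
  linarith

/-! ### Row sums against the diagonal -/

theorem exists_face (i : Fin d) (T : M.Elem) :
    ∃ F : M.Face, faceDir F = i ∧ adjInd F T = 1 := by
  by_cases h : (T i : ℕ) + 1 < M.N i
  · exact ⟨Sum.inl ⟨(i, T), h⟩, rfl, if_pos (by simp [adjElems, lowerElem])⟩
  · have h' : (T i : ℕ) + 1 = M.N i := by have := (T i).2; omega
    exact ⟨Sum.inr ⟨(i, true, T), Or.inl ⟨rfl, h'⟩⟩, rfl, if_pos (by simp [adjElems])⟩

/-- Every element has a face orthogonal to each direction, and distinct directions give distinct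
faces. Volume terms, indexed by directions, can thus be charged to faces. -/
theorem sum_le_sum_face (T : M.Elem) (g : Fin d → ℝ) (hg : ∀ i, 0 ≤ g i) :
    ∑ i, g i ≤ ∑ F : M.Face, adjInd F T * g (faceDir F) := by
  choose f hf1 hf2 using fun i => exists_face (M := M) i T
  have hinj : Function.Injective f := fun a b h => by rw [← hf1 a, h, hf1]
  calc ∑ i, g i = ∑ i, adjInd (f i) T * g (faceDir (f i)) := by simp [hf1, hf2]
    _ = ∑ F ∈ Finset.univ.map ⟨f, hinj⟩, adjInd F T * g (faceDir F) := by
        rw [Finset.sum_map]; rfl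
    _ ≤ _ := Finset.sum_le_sum_of_subset_of_nonneg (Finset.subset_univ _) fun F _ _ =>
        mul_nonneg (adjInd_nonneg F T) (hg _)

theorem sum_adjInd_le (F : M.Face) : ∑ T, adjInd F T ≤ 2 := by
  simp only [adjInd, Finset.sum_ite_mem, Finset.univ_inter, Finset.sum_const, nsmul_eq_mul,
    mul_one]
  exact_mod_cast card_adjElems_le F

theorem sum_volume_bound_le {k : ℕ} (p : M.BasisIndex k) :
    ∑ q : M.BasisIndex k, (if q.1 = p.1 then (1 : ℝ) else 0) *
      (∑ i, 4 * ((k : ℝ) ^ 2 / M.h) * M.faceGram i (degrees p) (degrees q)) ≤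
    4 * ((k : ℝ) ^ 2 / M.h) * ((k : ℝ) + 1) *
      ∑ F : M.Face, adjInd F p.1 * M.faceGram (faceDir F) (degrees p) (degrees p) := by
  have hh := M.h_pos
  rw [Fintype.sum_prod_type, Finset.sum_eq_single p.1 (fun T _ hT => by simp [hT]) (by simp)]
  simp only [if_true, one_mul]
  rw [Finset.sum_comm]
  calc _ ≤ ∑ i, 4 * ((k : ℝ) ^ 2 / M.h) *
        (((k : ℝ) + 1) * M.faceGram i (degrees p) (degrees p)) := by
        refine Finset.sum_le_sum fun i _ => ?_
        rw [← Finset.mul_sum]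
        exact mul_le_mul_of_nonneg_left (M.sum_faceGram_le k i _) (by positivity)
    _ = 4 * ((k : ℝ) ^ 2 / M.h) * ((k : ℝ) + 1) *
        ∑ i, M.faceGram i (degrees p) (degrees p) := by
        rw [Finset.mul_sum]
        exact Finset.sum_congr rfl fun i _ => by ring
    _ ≤ _ := by
        gcongr
        exact sum_le_sum_face p.1 _ fun i => M.faceGram_nonneg _ _ _

/-- The leading 2 counts the elements adjacent to a face, and `k + 1` the admissible normal degrees.
-/
theorem sum_face_bound_le {α₀ : ℝ} (hα : 0 ≤ α₀) {k : ℕ} (p : M.BasisIndex k) :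
    ∑ q : M.BasisIndex k, ∑ F : M.Face, adjInd F p.1 * adjInd F q.1 *
      ((4 + α₀) * ((k : ℝ) ^ 2 / M.h) * M.faceGram (faceDir F) (degrees p) (degrees q)) ≤
    2 * (4 + α₀) * ((k : ℝ) ^ 2 / M.h) * ((k : ℝ) + 1) *
      ∑ F : M.Face, adjInd F p.1 * M.faceGram (faceDir F) (degrees p) (degrees p) := by
  have hh := M.h_pos
  rw [Finset.sum_comm, Finset.mul_sum]
  refine Finset.sum_le_sum fun F _ => ?_
  have hsplit : ∑ q : M.BasisIndex k, adjInd F p.1 * adjInd F q.1 *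
      ((4 + α₀) * ((k : ℝ) ^ 2 / M.h) * M.faceGram (faceDir F) (degrees p) (degrees q)) =
      adjInd F p.1 * ((4 + α₀) * ((k : ℝ) ^ 2 / M.h)) * ((∑ T, adjInd F T) *
        ∑ τ : Fin d → Fin (k + 1),
          M.faceGram (faceDir F) (degrees p) (fun j => (τ j : ℕ))) := by
    rw [Finset.sum_mul_sum, Fintype.sum_prod_type, Finset.mul_sum]
    refine Finset.sum_congr rfl fun T _ => ?_
    rw [Finset.mul_sum]
    refine Finset.sum_congr rfl fun τ _ => ?_
    have : degrees (M := M) (T, τ) = fun j => (τ j : ℕ) := rfl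
    rw [this]
    ring
  rw [hsplit]
  refine (mul_le_mul_of_nonneg_left (mul_le_mul (sum_adjInd_le F) (M.sum_faceGram_le k _ _)
    (Finset.sum_nonneg fun τ _ => M.faceGram_nonneg _ _ _) zero_le_two)
    (mul_nonneg (adjInd_nonneg F p.1) (by positivity))).trans (le_of_eq ?_)
  ring

theorem sum_abs_stiffness_le (o : M.InteriorFace → Bool) {α₀ : ℝ} (hα : 0 ≤ α₀) {k : ℕ}
    (p : M.BasisIndex k) :
    ∑ q, |M.stiffness o α₀ k p q| ≤
      (12 + 2 * α₀) * ((k : ℝ) + 1) * ((k : ℝ) ^ 2 / M.h) *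
        ∑ F : M.Face, adjInd F p.1 * M.faceGram (faceDir F) (degrees p) (degrees p) := by
  refine (Finset.sum_le_sum fun q _ => abs_stiffness_le o hα p q).trans ?_
  rw [Finset.sum_add_distrib]
  refine (add_le_add (sum_volume_bound_le p) (sum_face_bound_le hα p)).trans (le_of_eq ?_)
  ring

theorem stiffness_self_pos (hd : 1 ≤ d) (o : M.InteriorFace → Bool) {α₀ : ℝ} (hα : 8 ≤ α₀)
    {k : ℕ} (hk : 1 ≤ k) (p : M.BasisIndex k) : 0 < M.stiffness o α₀ k p p := by
  have hh := M.h_pos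
  have hk' : (0 : ℝ) < k := by exact_mod_cast hk
  have : Nonempty (Fin d) := ⟨⟨0, hd⟩⟩
  refine lt_of_lt_of_le (mul_pos (mul_pos (by linarith) (by positivity)) ?_)
    (le_stiffness_self o α₀ p)
  refine lt_of_lt_of_le (Finset.sum_pos (fun i _ => M.faceGram_self_pos i (degrees p))
    Finset.univ_nonempty) (sum_le_sum_face p.1 _ fun i => M.faceGram_nonneg _ _ _)

theorem sum_abs_stiffness_le_mul_self (o : M.InteriorFace → Bool) {α₀ : ℝ} (hα : 8 ≤ α₀) {k : ℕ}
    (p : M.BasisIndex k) :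
    ∑ q, |M.stiffness o α₀ k p q| ≤
      (3 + α₀) * ((k : ℝ) + 1) * M.stiffness o α₀ k p p := by
  have hh := M.h_pos
  have h1 := le_stiffness_self o α₀ p
  have hQ : 0 ≤ ((k : ℝ) ^ 2 / M.h) *
      ∑ F : M.Face, adjInd F p.1 * M.faceGram (faceDir F) (degrees p) (degrees p) :=
    mul_nonneg (by positivity) (Finset.sum_nonneg fun F _ =>
      mul_nonneg (adjInd_nonneg _ _) (M.faceGram_nonneg _ _ _))
  rw [mul_assoc] at h1
  refine (sum_abs_stiffness_le o (by linarith) p).trans ?_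
  calc _ = ((k : ℝ) + 1) * ((12 + 2 * α₀) * (((k : ℝ) ^ 2 / M.h) *
        ∑ F : M.Face, adjInd F p.1 * M.faceGram (faceDir F) (degrees p) (degrees p))) := by ring
    _ ≤ ((k : ℝ) + 1) * ((3 + α₀) * M.stiffness o α₀ k p p) := by
        refine mul_le_mul_of_nonneg_left (le_trans ?_ (mul_le_mul_of_nonneg_left h1
          (show (0 : ℝ) ≤ 3 + α₀ by linarith))) (by positivity)
        rw [← mul_assoc (3 + α₀)]
        refine mul_le_mul_of_nonneg_right ?_ hQ
        -- The claim `12 + 2α₀ ≤ (3 + α₀)(α₀ - 4)` is `α₀² - 3α₀ - 24 ≥ 0`, which holds for `α₀ ≥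
        -- 8`.
        nlinarith
    _ = _ := by ring

end UniformMesh

/-! ### Gershgorin's theorem and conclusion -/

/-- The spectral radius of a complex matrix is at most its maximal absolute row sum. -/
theorem spectralRadius_le_of_row_sum_le {n : Type*} [Fintype n] [DecidableEq n]
    (A : Matrix n n ℂ) (r : ℝ) (h : ∀ i, ∑ j, ‖A i j‖ ≤ r) :
    spectralRadius ℂ A ≤ ENNReal.ofReal r := by
  refine iSup₂_le fun μ hμ => ?_
  rw [← Matrix.spectrum_toLin', ← Module.End.hasEigenvalue_iff_mem_spectrum] at hμ
  -- Gershgorin places `μ` in a disc about some `A i i`; adding the centre to the radius gives the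
  -- full row sum.
  obtain ⟨i, hi⟩ := eigenvalue_mem_ball hμ
  rw [Metric.mem_closedBall, dist_eq_norm] at hi
  have h1 : ‖μ‖ ≤ r := by
    calc ‖μ‖ = ‖A i i + (μ - A i i)‖ := by rw [add_sub_cancel]
      _ ≤ ‖A i i‖ + ∑ j ∈ Finset.univ.erase i, ‖A i j‖ :=
          (norm_add_le _ _).trans (add_le_add le_rfl hi)
      _ = ∑ j, ‖A i j‖ := Finset.add_sum_erase _ (fun j => ‖A i j‖) (Finset.mem_univ i)
      _ ≤ r := h i
  rw [← ENNReal.ofReal_coe_nnreal, coe_nnnorm]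
  exact ENNReal.ofReal_le_ofReal h1

end SIPDG
end

theorem mainTheorem6 (d : ℕ) (hd : 1 ≤ d) :
    ∃ αmin : ℝ, 0 < αmin ∧ ∀ α₀ : ℝ, αmin ≤ α₀ →
      ∃ C : ℝ, 0 < C ∧
        ∀ (M : SIPDG.UniformMesh d) (o : M.InteriorFace → Bool) (k : ℕ), 1 ≤ k →
          IsUnit (M.stiffnessDiag o α₀ k) ∧
          spectralRadius ℂ
              (((M.stiffnessDiag o α₀ k)⁻¹ * M.stiffness o α₀ k).map (algebraMap ℝ ℂ))
            ≤ ENNReal.ofReal (C * ((k : ℝ) + 1)) := by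
  -- The threshold 8 and the constant `3 + α₀` are convenient, not optimal: they satisfy the
  -- quadratic inequality behind `sum_abs_stiffness_le_mul_self`.
  refine ⟨8, by norm_num, fun α₀ hα => ⟨3 + α₀, by linarith, fun M o k hk => ?_⟩⟩
  have hpos := SIPDG.UniformMesh.stiffness_self_pos (M := M) hd o hα hk
  have hunit : IsUnit (M.stiffness o α₀ k).diag := by
    rw [Pi.isUnit_iff]
    exact fun p => (hpos p).ne'.isUnit
  refine ⟨Matrix.isUnit_diagonal.mpr hunit, SIPDG.spectralRadius_le_of_row_sum_le _ _ fun p => ?_⟩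
  have hentry : ∀ q, ‖(((M.stiffnessDiag o α₀ k)⁻¹ * M.stiffness o α₀ k).map
      (algebraMap ℝ ℂ)) p q‖ =
        (M.stiffness o α₀ k p p)⁻¹ * |M.stiffness o α₀ k p q| := by
    intro q
    have hinv : (M.stiffnessDiag o α₀ k)⁻¹ =
        Matrix.diagonal fun p => (M.stiffness o α₀ k p p)⁻¹ := by
      refine Matrix.inv_eq_left_inv ?_
      rw [SIPDG.UniformMesh.stiffnessDiag, Matrix.diagonal_mul_diagonal, ← Matrix.diagonal_one]
      congr 1
      funext p
      exact inv_mul_cancel₀ (hpos p).ne'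
    rw [hinv, Matrix.map_apply, Matrix.diagonal_mul, norm_algebraMap', Real.norm_eq_abs, abs_mul,
      abs_of_pos (inv_pos.mpr (hpos p))]
  rw [Finset.sum_congr rfl fun q _ => hentry q, ← Finset.mul_sum,
    inv_mul_le_iff₀ (hpos p), mul_comm]
  exact SIPDG.UniformMesh.sum_abs_stiffness_le_mul_self o hα p
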